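/- For every constant $c>0$ there are a constant $\delta>0$ and an integer $N$, depending only on $c$, such that the following holds for all integers $n\ge N$, all primes $p$ and all $k\in\mathbb{N}$ with $p^k>2^{cn}$. There exist $\alpha_1,\dots,\alpha_n\in\mathbb{F}_{p^k}$ and $\beta\in\mathbb{F}_{p^{2k}}\setminus\mathbb{F}_{p^k}$ such that, for $f=\sum_{i=1}^n\alpha_i x_i-\beta\in\mathbb{F}_{p^{2k}}[x_1,\dots,x_n]$: 1. $f(a)\neq 0$ for every $a\in\{0,1\}^n$; 2. every sparse-$\mathrm{IPS}_{\mathrm{LIN}'}$ refutation $C$ of $f$ over $\mathbb{F}_{p^{2k}}$ has size at least $2^{\delta n}$, and the polynomial computed by $C$ even has at least $2^{\delta n}$ monomials with nonzero coefficient. Here a sparse-$\mathrm{IPS}_{\mathrm{LIN}'}$ refutation of $f$ is a $\sum\prod$ formula $C$ (a depth-2 formula whose top gate computes a linear combination of leaves and of products of leaves, with unbounded fan-in, where leaves are variables or constants) over $\mathbb{F}_{p^{2k}}$ in the variables $x_1,\dots,x_n,y,z_1,\dots,z_n$ such that the polynomial $C(x,y,z)$ it computes has degree at most $1$ in $y$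 (the degree in the $z_i$ is not restricted), $C(x,0,0)=0$, and $C(x,f,x_1^2-x_1,\dots,x_n^2-x_n)=1$ as polynomials in $x$. The size of $C$ is its number of edges. -/

import Mathlib

namespace SparseIPS

/-- A leaf of an algebraic formula over `K` in the variables `τ`: a variable or a constant. -/
inductive Leaf (τ K : Type*) where
  | var (v : τ)
  | const (c : K)

/-- The polynomial computed by a leaf. -/
noncomputable def Leaf.toPoly {τ K : Type*} [CommSemiring K] : Leaf τ K → MvPolynomial τ K
  | .var v => MvPolynomial.X v
  | .const c => MvPolynomial.C c

/-- A child of the top addition gate of a depth-2 formula: either a leaf, or a multiplication gate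
of unbounded fan-in all of whose inputs are leaves. -/
inductive Summand (τ K : Type*) where
  | leaf (l : Leaf τ K)
  | prod (ls : List (Leaf τ K))

/-- The polynomial computed by a child of the top gate. -/
noncomputable def Summand.toPoly {τ K : Type*} [CommSemiring K] : Summand τ K → MvPolynomial τ K
  | .leaf l => l.toPoly
  | .prod ls => (ls.map Leaf.toPoly).prod

/-- The number of edges entering a child of the top gate. -/
def Summand.fanIn {τ K : Type*} : Summand τ K → ℕ
  | .leaf _ => 0
  | .prod ls => ls.length

/-- A `∑∏` formula (depth two, unbounded fan-in) over `K` in the variables `τ`. The top addition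
gate computes a linear combination of its children; each child is listed with its coefficient. -/
structure SigmaPiFormula (τ K : Type*) where
  children : List (K × Summand τ K)

/-- The polynomial computed by a `∑∏` formula. -/
noncomputable def SigmaPiFormula.toPoly {τ K : Type*} [CommSemiring K]
    (C : SigmaPiFormula τ K) : MvPolynomial τ K :=
  (C.children.map fun t => MvPolynomial.C t.1 * t.2.toPoly).sum

/-- The size of a `∑∏` formula: its number of edges. Each child contributes the edge joining it to
the top gate and the edges that enter it. -/
def SigmaPiFormula.size {τ K : Type*} (C : SigmaPiFormula τ K) : ℕ :=
  (C.children.map fun t => 1 + t.2.fanIn).sum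

/-- The variables of an IPS refutation of a system indexed by `ι` in the variables `x` indexed by
`σ`: the variables `x` (indexed by `σ`), the placeholders `y` for the polynomials of the system
(indexed by `ι`) and the placeholders `z` for the Boolean axioms (indexed by `σ`). -/
abbrev IPSVar (σ ι : Type*) := σ ⊕ (ι ⊕ σ)

/-- `P(x, y, z)` is an IPS refutation of the system `f` over the Boolean cube:
`P(x, 0, 0) = 0` and `P(x, f, x² - x) = 1`. -/
structure IsIPS {σ ι K : Type*} [CommRing K] (f : ι → MvPolynomial σ K)
    (P : MvPolynomial (IPSVar σ ι) K) : Prop where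
  eval_zero : MvPolynomial.aeval
    (Sum.elim MvPolynomial.X (fun _ => 0) : IPSVar σ ι → MvPolynomial σ K) P = 0
  eval_axioms : MvPolynomial.aeval
    (Sum.elim MvPolynomial.X
      (Sum.elim f fun i => MvPolynomial.X i ^ 2 - MvPolynomial.X i) :
        IPSVar σ ι → MvPolynomial σ K) P = 1

/-- An `IPS_LIN'` refutation: an IPS refutation of individual degree at most one in each of the
variables `y` (but not necessarily in `z`). -/
structure IsIPSLin' {σ ι K : Type*} [CommRing K] (f : ι → MvPolynomial σ K)
    (P : MvPolynomial (IPSVar σ ι) K) : Prop extends IsIPS f P where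
  degreeOf_le_one : ∀ j : ι, MvPolynomial.degreeOf (Sum.inr (Sum.inl j) : IPSVar σ ι) P ≤ 1

/-- A sparse-`IPS_LIN'` refutation of the single polynomial `f`: a `∑∏` formula computing an
`IPS_LIN'` refutation of the one-element system `f`. -/
def IsSparseIPSLin' {σ K : Type*} [CommRing K] (f : MvPolynomial σ K)
    (C : SigmaPiFormula (IPSVar σ Unit) K) : Prop :=
  IsIPSLin' (fun _ : Unit => f) C.toPoly

/-- The subset-sum polynomial `∑ i, α i * x i - β`. -/
noncomputable def subsetSum {K : Type*} [CommRing K] {n : ℕ} (α : Fin n → K) (β : K) :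
    MvPolynomial (Fin n) K :=
  ∑ i, MvPolynomial.C (α i) * MvPolynomial.X i - MvPolynomial.C β

end SparseIPS

namespace SparseIPS

open Finset

/-! On the cube `z = x² - x` vanishes, so subtracting `P(a, 0, 0) = 0` from `P(a, f(a), 0) = 1`
leaves `f(a) * g(a) = 1`, where `g` comes from the monomials of `P` linear in `y` and free of `z`.
If the alternating sum of `1 / f` over the subsets of `S` is nonzero, Möbius inversion gives a
monomial of `P` whose support in `x` is exactly `S`. Hence if this holds for all `S ⊆ M`, then `P`
has at least `2 ^ #M` monomials.

To find such `α`, clear denominators: each alternating sum becomes a nonzero polynomial in `α` of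
degree below `2 ^ #S` (`alternatingNumerator_ne_zero`). The product over `S ⊆ M` has degree below `4
^ #M ≤ |F|`, so it has a nonroot in `F ^ n`. As `β ∉ F`, no denominator vanishes there. -/

theorem sum_powerset_neg_one_pow_mul_eq_zero {σ R : Type*} [DecidableEq σ] [CommRing R]
    {S : Finset σ} {i : σ} (hi : i ∈ S) (F : Finset σ → R) (h : ∀ T, F (insert i T) = F T) :
    ∑ T ∈ S.powerset, (-1) ^ #T * F T = 0 := by
  rw [← insert_erase hi, sum_powerset_insert (notMem_erase i S), ← sum_add_distrib]
  refine sum_eq_zero fun T hT => ?_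
  have hiT : i ∉ T := fun hm => notMem_erase i S (mem_powerset.mp hT hm)
  rw [card_insert_of_notMem hiT, h, pow_succ]
  ring

/-- The alternating sum over the subsets of `S` of the values of a polynomial on the Boolean cube
vanishes unless the polynomial has a monomial with support `S`. -/
theorem exists_support_eq_of_alternating_sum_ne_zero {σ ι R : Type*} [Fintype σ] [DecidableEq σ]
    [CommRing R] (D : Finset ι) (e : ι → R) (d : ι → σ → ℕ) (S : Finset σ)
    (h : ∑ T ∈ S.powerset, (-1) ^ #T *
      ∑ j ∈ D, e j * ∏ i, (if i ∈ T then (1 : R) else 0) ^ d j i ≠ 0) :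
    ∃ j ∈ D, univ.filter (fun i => d j i ≠ 0) = S := by
  by_contra! hne
  apply h
  simp_rw [mul_sum]
  rw [sum_comm]
  refine sum_eq_zero fun j hj => ?_
  by_cases hsub : ∃ i ∈ S, d j i = 0
  · obtain ⟨i, hi, hdi⟩ := hsub
    refine sum_powerset_neg_one_pow_mul_eq_zero hi
      (fun T => e j * ∏ i, (if i ∈ T then (1 : R) else 0) ^ d j i) fun T => ?_
    congr 1
    refine prod_congr rfl fun l _ => ?_
    by_cases hl : l = i
    · simp [hl, hdi]
    · simp [hl]
  -- The monomial involves a variable outside `S`, so it vanishes at every `T ⊆ S`.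
  · push Not at hsub
    obtain ⟨i, hdi, hi⟩ : ∃ i, d j i ≠ 0 ∧ i ∉ S := by
      by_contra! hall
      refine hne j hj (Finset.ext fun i => ?_)
      simp only [mem_filter, mem_univ, true_and]
      exact ⟨hall i, hsub i⟩
    refine sum_eq_zero fun T hT => ?_
    rw [prod_eq_zero (mem_univ i), mul_zero, mul_zero]
    rw [if_neg fun hm => hi (mem_powerset.mp hT hm), zero_pow hdi]

/-- The linear form `∑ i ∈ U, X i - β`. -/
noncomputable def subsetForm {σ K : Type*} [CommRing K] (β : K) (U : Finset σ) :
    MvPolynomial σ K :=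
  ∑ i ∈ U, MvPolynomial.X i - MvPolynomial.C β

/-- The numerator of the alternating sum `∑ T ⊆ S, (-1) ^ |T| / (∑ i ∈ T, X i - β)`. -/
noncomputable def alternatingNumerator {σ K : Type*} [DecidableEq σ] [CommRing K] (β : K)
    (S : Finset σ) : MvPolynomial σ K :=
  ∑ T ∈ S.powerset, (-1) ^ #T * ∏ U ∈ S.powerset.erase T, subsetForm β U

theorem eval_alternatingNumerator {σ K : Type*} [DecidableEq σ] [Field K] {β : K} {S : Finset σ}
    {α : σ → K} (h : ∀ U, ∑ i ∈ U, α i - β ≠ 0) :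
    MvPolynomial.eval α (alternatingNumerator β S) =
      (∏ U ∈ S.powerset, (∑ i ∈ U, α i - β)) *
        ∑ T ∈ S.powerset, (-1) ^ #T * (∑ i ∈ T, α i - β)⁻¹ := by
  simp only [alternatingNumerator, subsetForm, map_sum, map_mul, map_pow, map_neg, map_one,
    map_prod, map_sub, MvPolynomial.eval_X, MvPolynomial.eval_C]
  rw [mul_sum]
  refine sum_congr rfl fun T hT => ?_
  rw [← mul_prod_erase _ _ hT]
  field_simp [h T]

theorem totalDegree_subsetForm_le {σ K : Type*} [CommRing K] [Nontrivial K] (β : K)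
    (U : Finset σ) : (subsetForm β U).totalDegree ≤ 1 := by
  refine (MvPolynomial.totalDegree_sub _ _).trans (max_le ?_ ?_)
  · exact MvPolynomial.totalDegree_finsetSum_le fun i _ => (MvPolynomial.totalDegree_X i).le
  · simp

theorem totalDegree_alternatingNumerator_lt {σ K : Type*} [DecidableEq σ] [CommRing K]
    [Nontrivial K] (β : K) (S : Finset σ) :
    (alternatingNumerator β S).totalDegree < 2 ^ #S := by
  suffices h : (alternatingNumerator β S).totalDegree ≤ 2 ^ #S - 1 by
    have := Nat.one_le_two_pow (n := #S)
    lia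
  refine MvPolynomial.totalDegree_finsetSum_le fun T hT => ?_
  have h1 : ((-1 : MvPolynomial σ K) ^ #T).totalDegree ≤ 0 := by
    refine (MvPolynomial.totalDegree_pow _ _).trans ?_
    simp
  have h2 : (∏ U ∈ S.powerset.erase T, subsetForm β U : MvPolynomial σ K).totalDegree
      ≤ 2 ^ #S - 1 := by
    refine (MvPolynomial.totalDegree_finsetProd _ _).trans ?_
    refine (sum_le_card_nsmul _ _ 1 fun U _ => totalDegree_subsetForm_le β U).trans ?_
    rw [card_erase_of_mem hT, card_powerset, smul_eq_mul, mul_one]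
  exact (MvPolynomial.totalDegree_mul _ _).trans (by lia)

/-- A substitution into `K[X]` kills the form of `S` but that of no other subset of `S`. Every term
with `T ≠ S` contains the form of `S`, so only `T = S` survives. -/
theorem alternatingNumerator_ne_zero {n : ℕ} {K : Type*} [Field K] {β : K} (hβ : β ≠ 0)
    (S : Finset (Fin n)) : alternatingNumerator β S ≠ 0 := by
  classical
  rcases S.eq_empty_or_nonempty with rfl | ⟨i₀, hi₀⟩
  · simp [alternatingNumerator]
  -- The powers are distinct and positive, so subsets are told apart by coefficients and `β` sits
  -- alone in degree 0; the value at `i₀` makes the sum over `S` equal `β`.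
  let θ : Fin n → Polynomial K := fun i =>
    if i = i₀ then Polynomial.C β - ∑ j ∈ S.erase i₀, Polynomial.X ^ ((j : ℕ) + 1)
    else Polynomial.X ^ ((i : ℕ) + 1)
  have hθ₀ : θ i₀ = Polynomial.C β - ∑ j ∈ S.erase i₀, Polynomial.X ^ ((j : ℕ) + 1) := if_pos rfl
  have hθ : ∀ U : Finset (Fin n), i₀ ∉ U → ∑ i ∈ U, θ i = ∑ i ∈ U, Polynomial.X ^ ((i : ℕ) + 1) :=
    fun U hU => sum_congr rfl fun i hi => if_neg fun (h : i = i₀) => hU (h ▸ hi)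
  have hform : ∀ U : Finset (Fin n), MvPolynomial.aeval θ (subsetForm β U) =
      ∑ i ∈ U, θ i - Polynomial.C β := fun U => by
    simp [subsetForm, Polynomial.algebraMap_eq]
  have hmem : ∀ U : Finset (Fin n), i₀ ∈ U → MvPolynomial.aeval θ (subsetForm β U) =
      ∑ i ∈ U.erase i₀, Polynomial.X ^ ((i : ℕ) + 1) -
        ∑ j ∈ S.erase i₀, Polynomial.X ^ ((j : ℕ) + 1) := fun U hU => by
    rw [hform, ← add_sum_erase U θ hU, hθ₀, hθ _ (notMem_erase i₀ U)]
    ring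
  have hcoeff : ∀ (U : Finset (Fin n)) (j : Fin n),
      (∑ i ∈ U, (Polynomial.X : Polynomial K) ^ ((i : ℕ) + 1)).coeff ((j : ℕ) + 1) =
        if j ∈ U then 1 else 0 := fun U j => by
    simp only [Polynomial.finsetSum_coeff, Polynomial.coeff_X_pow, add_left_inj, Fin.val_inj]
    simp
  intro h0
  have h := congrArg (MvPolynomial.aeval θ) h0
  have hS : MvPolynomial.aeval θ (subsetForm β S) = 0 := by rw [hmem S hi₀, sub_self]
  simp only [alternatingNumerator, map_sum, map_mul, map_pow, map_neg, map_one, map_prod,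
    map_zero] at h
  rw [sum_eq_single S ?_ fun hn => (hn (mem_powerset_self S)).elim] at h
  · refine mul_ne_zero (pow_ne_zero _ (neg_ne_zero.mpr one_ne_zero)) (prod_ne_zero_iff.mpr ?_) h
    intro U hU hzero
    rw [mem_erase, mem_powerset] at hU
    by_cases hi : i₀ ∈ U
    · obtain ⟨j, hjS, hjU⟩ := exists_of_ssubset (hU.2.ssubset_of_ne hU.1)
      have hj : j ≠ i₀ := fun h => hjU (h ▸ hi)
      have := congrArg (fun P => Polynomial.coeff P ((j : ℕ) + 1)) ((hmem U hi).symm.trans hzero)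
      simp only [Polynomial.coeff_sub, hcoeff] at this
      simp [hj, hjS, hjU] at this
    · have := congrArg (fun P => Polynomial.coeff P 0) ((hform U).symm.trans hzero)
      simp only [hθ U hi, Polynomial.coeff_sub, Polynomial.finsetSum_coeff] at this
      simp [hβ] at this
  · intro T _ hTS
    rw [prod_eq_zero (mem_erase.mpr ⟨hTS.symm, mem_powerset_self S⟩) hS, mul_zero]

/-- Over a large finite subfield `F`, the coefficients `α` can be chosen so that the multilinear
polynomial representing `1 / (∑ i, α i * x i - β)` on the Boolean cube contains every monomial
supported in `M`. -/
theorem exists_alternating_sum_ne_zero {n : ℕ} {K : Type*} [Field K] (F : Subfield K) [Finite F]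
    {β : K} (hβ : β ∉ F) (M : Finset (Fin n)) (hM : 2 ^ #M * 2 ^ #M ≤ Nat.card F) :
    ∃ α : Fin n → K, (∀ i, α i ∈ F) ∧
      ∀ S ⊆ M, ∑ T ∈ S.powerset, (-1) ^ #T * (∑ i ∈ T, α i - β)⁻¹ ≠ 0 := by
  classical
  have hβ0 : β ≠ 0 := fun h => hβ (h ▸ F.zero_mem)
  have hfin : (F : Set K).Finite := Set.toFinite _
  have hcard : #hfin.toFinset = Nat.card F := (Nat.card_eq_card_finite_toFinset hfin).symm
  let P : MvPolynomial (Fin n) K := ∏ S ∈ M.powerset, alternatingNumerator β S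
  have hP : P ≠ 0 := prod_ne_zero_iff.mpr fun S _ => alternatingNumerator_ne_zero hβ0 S
  have hdeg : P.totalDegree < 2 ^ #M * 2 ^ #M := by
    refine (MvPolynomial.totalDegree_finsetProd _ _).trans_lt ?_
    calc ∑ S ∈ M.powerset, (alternatingNumerator β S).totalDegree
        < ∑ S ∈ M.powerset, 2 ^ #M := by
          refine sum_lt_sum_of_nonempty (powerset_nonempty M) fun S hS => ?_
          exact (totalDegree_alternatingNumerator_lt β S).trans_le
            (Nat.pow_le_pow_right two_pos (card_le_card (mem_powerset.mp hS)))
      _ = 2 ^ #M * 2 ^ #M := by simp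
  have hex : ∃ α : Fin n → K, (∀ i, α i ∈ hfin.toFinset) ∧ MvPolynomial.eval α P ≠ 0 := by
    by_contra! hall
    refine hP (MvPolynomial.eq_zero_of_eval_zero_at_prod_finset P (fun _ => hfin.toFinset) ?_ hall)
    intro i
    rw [hcard]
    exact ((MvPolynomial.degreeOf_le_totalDegree P i).trans_lt hdeg).trans_le hM
  obtain ⟨α, hα, hne⟩ := hex
  have hαF : ∀ i, α i ∈ F := fun i => by simpa using hα i
  refine ⟨α, hαF, fun S hS hzero => ?_⟩
  have hU : ∀ U : Finset (Fin n), ∑ i ∈ U, α i - β ≠ 0 := fun U h =>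
    hβ (sub_eq_zero.mp h ▸ F.sum_mem fun i _ => hαF i)
  rw [map_prod, prod_ne_zero_iff] at hne
  refine hne S (mem_powerset.mpr hS) ?_
  rw [eval_alternatingNumerator hU, hzero, mul_zero]

theorem eval_subsetSum {n : ℕ} {K : Type*} [CommRing K] (α : Fin n → K) (β : K) (a : Fin n → K) :
    MvPolynomial.eval a (subsetSum α β) = ∑ i, α i * a i - β := by
  simp [subsetSum]

theorem IsIPS.eval_cube {σ ι K : Type*} [CommRing K] {f : ι → MvPolynomial σ K}
    {P : MvPolynomial (IPSVar σ ι) K} (h : IsIPS f P) {a : σ → K} (ha : ∀ i, a i = 0 ∨ a i = 1) :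
    MvPolynomial.eval (Sum.elim a fun _ => 0) P = 0 ∧
      MvPolynomial.eval (Sum.elim a (Sum.elim (fun j => MvPolynomial.eval a (f j)) fun _ => 0)) P
        = 1 := by
  have key : ∀ g : IPSVar σ ι → MvPolynomial σ K,
      MvPolynomial.eval a (MvPolynomial.aeval g P) =
        MvPolynomial.eval (fun v => MvPolynomial.eval a (g v)) P := fun g => by
    rw [MvPolynomial.aeval_def, MvPolynomial.algebraMap_eq, MvPolynomial.eval_eval₂]
    simp only [MvPolynomial.eval, MvPolynomial.coe_eval₂Hom]
    congr 1
    ext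
    simp
  have h0 := congrArg (MvPolynomial.eval a) h.eval_zero
  have h1 := congrArg (MvPolynomial.eval a) h.eval_axioms
  have g0 : (fun v : IPSVar σ ι => MvPolynomial.eval a
      ((Sum.elim MvPolynomial.X fun _ => 0 : IPSVar σ ι → MvPolynomial σ K) v)) =
        Sum.elim a fun _ => 0 := by
    funext v
    rcases v with i | j <;> simp
  have g1 : (fun v : IPSVar σ ι => MvPolynomial.eval a
      ((Sum.elim MvPolynomial.X (Sum.elim f fun i => MvPolynomial.X i ^ 2 - MvPolynomial.X i) :
        IPSVar σ ι → MvPolynomial σ K) v)) =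
        Sum.elim a (Sum.elim (fun j => MvPolynomial.eval a (f j)) fun _ => 0) := by
    funext v
    rcases v with i | j | i
    · simp
    · simp
    · rcases ha i with hi | hi <;> simp [hi]
  rw [key, map_zero, g0] at h0
  rw [key, map_one, g1] at h1
  exact ⟨h0, h1⟩

/-- On the Boolean cube, the part of an `IPS_LIN'` refutation of `f` that is linear in `y` and free
of `z` is an inverse of `f`; its monomials are among those of the refutation. -/
theorem IsIPSLin'.exists_inverse {σ K : Type*} [Fintype σ] [CommRing K] {f : MvPolynomial σ K}
    {P : MvPolynomial (IPSVar σ Unit) K} (h : IsIPSLin' (fun _ : Unit => f) P) :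
    ∃ e : (IPSVar σ Unit →₀ ℕ) → K, ∀ a : σ → K, (∀ i, a i = 0 ∨ a i = 1) →
      MvPolynomial.eval a f * ∑ d ∈ P.support, e d * ∏ i, a i ^ d (Sum.inl i) = 1 := by
  -- With `0 ^ 0 = 1`, the product of powers of zero selects the monomials free of `z`.
  refine ⟨fun d => P.coeff d * ((if d (Sum.inr (Sum.inl ())) = 1 then 1 else 0) *
    ∏ i, (0 : K) ^ d (Sum.inr (Sum.inr i))), fun a ha => ?_⟩
  obtain ⟨h0, h1⟩ := h.toIsIPS.eval_cube ha
  refine Eq.trans ?_ ((congrArg₂ (· - ·) h1 h0).trans (sub_zero 1))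
  dsimp only
  rw [MvPolynomial.eval_eq' _ P, MvPolynomial.eval_eq' _ P, ← sum_sub_distrib, mul_sum]
  refine sum_congr rfl fun d hd => ?_
  have hle := MvPolynomial.degreeOf_le_iff.mp (h.degreeOf_le_one ()) d hd
  simp only [Fintype.prod_sum_type, Sum.elim_inl, Sum.elim_inr, univ_unique, prod_singleton,
    PUnit.default_eq_unit]
  rcases Nat.le_one_iff_eq_zero_or_eq_one.mp hle with hy | hy
  · simp [hy]
  · simp [hy]
    ring

/-- A lower bound on the number of monomials of an `IPS_LIN'` refutation of a subset-sum
polynomial. -/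
theorem IsIPSLin'.two_pow_le_card_support {n : ℕ} {K : Type*} [Field K] {α : Fin n → K} {β : K}
    {P : MvPolynomial (IPSVar (Fin n) Unit) K} (h : IsIPSLin' (fun _ : Unit => subsetSum α β) P)
    (M : Finset (Fin n))
    (hM : ∀ S ⊆ M, ∑ T ∈ S.powerset, (-1) ^ #T * (∑ i ∈ T, α i - β)⁻¹ ≠ 0) :
    2 ^ #M ≤ #P.support := by
  classical
  obtain ⟨e, he⟩ := h.exists_inverse
  have hinv : ∀ T : Finset (Fin n), (∑ i ∈ T, α i - β)⁻¹ =
      ∑ d ∈ P.support, e d * ∏ i, (if i ∈ T then (1 : K) else 0) ^ d (Sum.inl i) := fun T => by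
    have := he (fun i => if i ∈ T then 1 else 0) fun i => by by_cases hi : i ∈ T <;> simp [hi]
    rw [eval_subsetSum] at this
    simp only [mul_ite, mul_one, mul_zero, sum_ite_mem, univ_inter] at this
    exact inv_eq_of_mul_eq_one_right this
  rw [← card_powerset]
  -- Taking supports in `x` sends the monomials of `P` onto a family containing every `S ⊆ M`.
  refine (card_le_card fun S hS => ?_).trans (card_image_le (s := P.support)
    (f := fun d => univ.filter fun i : Fin n => d (Sum.inl i) ≠ 0))
  have hne := hM S (mem_powerset.mp hS)
  simp_rw [hinv] at hne
  exact mem_image.mpr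
    (exists_support_eq_of_alternating_sum_ne_zero P.support e (fun d i => d (Sum.inl i)) S hne)

theorem Leaf.exists_toPoly_eq_monomial {τ K : Type*} [CommSemiring K] (l : Leaf τ K) :
    ∃ d c, l.toPoly = MvPolynomial.monomial d c := by
  cases l with
  | var v => exact ⟨_, _, rfl⟩
  | const c => exact ⟨_, _, rfl⟩

theorem Summand.exists_toPoly_eq_monomial {τ K : Type*} [CommSemiring K] (s : Summand τ K) :
    ∃ d c, s.toPoly = MvPolynomial.monomial d c := by
  cases s with
  | leaf l => exact l.exists_toPoly_eq_monomial
  | prod ls =>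
    induction ls with
    | nil => exact ⟨0, 1, rfl⟩
    | cons l ls ih =>
      obtain ⟨d, c, h⟩ := ih
      obtain ⟨d', c', h'⟩ := l.exists_toPoly_eq_monomial
      refine ⟨d' + d, c' * c, ?_⟩
      simp only [Summand.toPoly, List.map_cons, List.prod_cons] at h ⊢
      rw [h, h', MvPolynomial.monomial_mul]

theorem SigmaPiFormula.card_support_toPoly_le_size {τ K : Type*} [CommSemiring K]
    (C : SigmaPiFormula τ K) : #C.toPoly.support ≤ C.size := by
  classical
  obtain ⟨l⟩ := C
  simp only [SigmaPiFormula.toPoly, SigmaPiFormula.size]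
  induction l with
  | nil => simp
  | cons t l ih =>
    simp only [List.map_cons, List.sum_cons]
    refine (card_le_card MvPolynomial.support_add).trans ((card_union_le _ _).trans ?_)
    refine add_le_add (le_add_right ?_) ih
    obtain ⟨d, c, h⟩ := t.2.exists_toPoly_eq_monomial
    rw [h, MvPolynomial.C_mul_monomial]
    exact (card_le_card MvPolynomial.support_monomial_subset).trans (card_singleton d).le

end SparseIPS

theorem mainTheorem1 :
    ∀ c : ℝ, 0 < c → ∃ δ : ℝ, 0 < δ ∧ ∃ N : ℕ, ∀ n : ℕ, N ≤ n →
      ∀ p k : ℕ, p.Prime → (2 : ℝ) ^ (c * (n : ℝ)) < (p : ℝ) ^ k →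
      ∀ (K : Type*) [Field K] (F : Subfield K),
        Nat.card K = p ^ (2 * k) → Nat.card F = p ^ k →
        ∃ (α : Fin n → K) (β : K), (∀ i, α i ∈ F) ∧ β ∉ F ∧
          (∀ a : Fin n → K, (∀ i, a i = 0 ∨ a i = 1) →
            MvPolynomial.eval a (SparseIPS.subsetSum α β) ≠ 0) ∧
          (∀ C : SparseIPS.SigmaPiFormula (SparseIPS.IPSVar (Fin n) Unit) K,
            SparseIPS.IsSparseIPSLin' (SparseIPS.subsetSum α β) C →
              (2 : ℝ) ^ (δ * (n : ℝ)) ≤ (C.size : ℝ) ∧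
              (2 : ℝ) ^ (δ * (n : ℝ)) ≤ (C.toPoly.support.card : ℝ)) := by
  intro c hc
  -- For `m = ⌊ε n⌋`, the bound `c / 2` gives `4 ^ m ≤ p ^ k` and the bound `1` gives `m ≤ n`.
  -- Taking `n ≥ 2 / ε` makes `ε n - 1 ≥ ε n / 2`, which absorbs the floor.
  let ε : ℝ := min (c / 2) 1
  have hε : 0 < ε := lt_min (half_pos hc) one_pos
  obtain ⟨N, hN⟩ := exists_nat_ge (2 / ε)
  refine ⟨ε / 2, half_pos hε, N, fun n hn p k hp hpk K _ F hK hF => ?_⟩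
  have hn' : 2 ≤ ε * n := by
    rw [mul_comm, ← div_le_iff₀ hε]
    exact hN.trans (Nat.cast_le.mpr hn)
  let m : ℕ := ⌊ε * n⌋₊
  have hm_le : (m : ℝ) ≤ ε * n := Nat.floor_le (by positivity)
  have hm_ge : ε / 2 * n ≤ m := by
    have := Nat.lt_floor_add_one (ε * (n : ℝ))
    change _ < (m : ℝ) + 1 at this
    linarith
  have hmn : m ≤ n := by
    have : (m : ℝ) ≤ n := hm_le.trans
      (mul_le_of_le_one_left (Nat.cast_nonneg n) (min_le_right _ _))
    exact_mod_cast this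
  have hmq : 2 ^ m * 2 ^ m ≤ p ^ k := by
    have h1 : (m : ℝ) + m ≤ c * n := by
      have : ε * n ≤ c / 2 * n := mul_le_mul_of_nonneg_right (min_le_left _ _) (Nat.cast_nonneg n)
      linarith
    have h2 : (2 : ℝ) ^ ((m : ℝ) + m) ≤ (p : ℝ) ^ k :=
      (Real.rpow_le_rpow_of_exponent_le one_le_two h1).trans hpk.le
    rw [Real.rpow_add two_pos, Real.rpow_natCast] at h2
    exact_mod_cast h2
  have hq : 1 < p ^ k := by
    have h1 : (1 : ℝ) ≤ 2 ^ (c * (n : ℝ)) :=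
      Real.one_le_rpow one_le_two (by positivity)
    exact_mod_cast h1.trans_lt hpk
  have : Finite K := Nat.finite_of_card_ne_zero (hK ▸ pow_ne_zero _ hp.ne_zero)
  obtain ⟨β, hβ⟩ : ∃ β, β ∉ F := by
    by_contra! hall
    have h1 : F = ⊤ := eq_top_iff.mpr fun x _ => hall x
    have h2 : Nat.card F = Nat.card K := by
      rw [h1]
      exact Nat.card_congr Subfield.topEquiv.toEquiv
    rw [hF, hK, two_mul, pow_add] at h2
    nlinarith
  obtain ⟨M, -, hM⟩ := Finset.exists_subset_card_eq
    (s := (Finset.univ : Finset (Fin n))) (n := m) (by simpa using hmn)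
  obtain ⟨α, hα, hne⟩ := SparseIPS.exists_alternating_sum_ne_zero F hβ M (by rw [hM, hF]; exact hmq)
  refine ⟨α, β, hα, hβ, fun a ha h => ?_, fun C hC => ?_⟩
  · rw [SparseIPS.eval_subsetSum, sub_eq_zero] at h
    refine hβ (h ▸ F.sum_mem fun i _ => F.mul_mem (hα i) ?_)
    rcases ha i with hi | hi <;> simp [hi, F.zero_mem, F.one_mem]
  · have h1 : (2 : ℝ) ^ (ε / 2 * n) ≤ (C.toPoly.support.card : ℝ) := by
      refine (Real.rpow_le_rpow_of_exponent_le one_le_two hm_ge).trans ?_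
      rw [Real.rpow_natCast]
      have := SparseIPS.IsIPSLin'.two_pow_le_card_support hC M hne
      rw [hM] at this
      exact_mod_cast this
    exact ⟨h1.trans (Nat.cast_le.mpr C.card_support_toPoly_le_size), h1⟩
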